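/- Let $p$ be a prime and let $\nu$ and $n$ be positive integers with $p\nmid n$. Let $\mathbb{F}_{p^{2\nu}}$ be the finite field of order $p^{2\nu}$. A cyclic code of length $N$ over $\mathbb{F}_{p^{2\nu}}$ is an ideal $C$ of the group algebra $\mathbb{F}_{p^{2\nu}}[\mathbb{Z}/N\mathbb{Z}]$, whose elements are written $u=\sum_{g}u_gY^g$. Its Hermitian dual is $C^{\perp_{\rm H}}=\{v : \sum_{g} c_g v_g^{p^\nu}=0 \text{ for all } c\in C\}$, and $C$ is called Hermitian complementary dual if $C\cap C^{\perp_{\rm H}}=\{0\}$. For a positive integer $d$, let $\lambda(d,p^\nu)=1$ if there is an odd positive integer $i$ with $d\mid p^{\nu i}+1$, and $\lambda(d,p^\nu)=0$ otherwise. Let $\Phi$ be Euler's totient function and, for $\gcd(i,d)=1$, let ${\rm ord}_d(i)$ be the multiplicative order of $i$ modulo $d$. Then, for every integer $k\ge 0$, the number of Hermitian complementary dual cyclic codes of length $np^k$ over $\mathbb{F}_{p^{2\nu}}$ equals the number of Hermitian complementary dual cyclic codes of length $n$ over $\mathbb{F}_{p^{2\nu}}$, and this number is \[2^{\sum_{d\mid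 n}\lambda(d,p^\nu)\frac{\Phi(d)}{{\rm ord}_d(p^{2\nu})}+\frac12\sum_{d\mid n}\left(1-\lambda(d,p^\nu)\right)\frac{\Phi(d)}{{\rm ord}_d(p^{2\nu})}}.\] -/

import Mathlib

namespace CyclicLCD

noncomputable section

open scoped AddMonoidAlgebra

/-- The Hermitian inner product `∑ g, u_g * v_g ^ q` on the group algebra `F[G]` of a finite
abelian group, for a field `F` of order `q ^ 2`. -/
def hermitianInner {F G : Type*} [Field F] [AddCommGroup G] [Fintype G] (q : ℕ)
    (u v : F[G]) : F :=
  ∑ g : G, u.coeff g * v.coeff g ^ q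

/-- The Hermitian dual of an abelian code, that is, of an ideal of `F[G]`. -/
def hermitianDual {F G : Type*} [Field F] [AddCommGroup G] [Fintype G] (q : ℕ)
    (C : Ideal F[G]) : Set F[G] :=
  {v | ∀ c ∈ C, hermitianInner q c v = 0}

/-- The code `C` meets its Hermitian dual only in `0`. -/
def IsHermitianComplementaryDual {F G : Type*} [Field F] [AddCommGroup G] [Fintype G] (q : ℕ)
    (C : Ideal F[G]) : Prop :=
  (C : Set F[G]) ∩ hermitianDual q C = {0}

/-- The number of Hermitian complementary dual cyclic codes of length `N` over `F`, a field of
order `q ^ 2`. A cyclic code of length `N` is an ideal of the group algebra `F[ℤ/N]`. -/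
def numHermitianLCDCyclic (F : Type*) [Field F] (q N : ℕ) [NeZero N] : ℕ :=
  Nat.card {C : Ideal F[ZMod N] // IsHermitianComplementaryDual q C}

open Classical in
/-- `lam d q` is `1` if `d ∣ q ^ i + 1` for some odd positive integer `i`, and `0` otherwise. -/
def lam (d q : ℕ) : ℕ :=
  if ∃ i : ℕ, Odd i ∧ d ∣ q ^ i + 1 then 1 else 0

/-- The multiplicative order of `i` modulo `d`, for `i` coprime to `d`. -/
def ordMod (d i : ℕ) : ℕ := orderOf (i : ZMod d)

end

end CyclicLCD

/-! Write q = p^ν. The Hermitian form of u and v is the coefficient at 0 of u times `conj` v, and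
`conj` is a ring involution. So the dual of an ideal C is the `conj`-image of its annihilator, and C
meets its dual trivially exactly when C is generated by an idempotent fixed by `conj`
(`card_isHermitianComplementaryDual`).

An idempotent equals its own p^k-th power, and such powers lie in the copy of F[ℤ/n] inside F[ℤ/(n
p^k)]. This removes the factor p^k (`card_fixed_idempotent_mul_pow`).

When p ∤ n, the Fourier transform over an algebraic closure turns idempotents into 0/1-valued
functions and `conj` into the permutation j ↦ -qj. The fixed idempotents are thus the unions of
orbits of -q on ℤ/n (`card_fixed_idempotent`). The elements of additive order d form Φ(d)/ord_d(-q)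
orbits, and ord_d(-q) is ord_d(q²) or twice that, according to `lam` (`totient_div_orderOf_neg`). -/

namespace CyclicLCD

open scoped AddMonoidAlgebra

/-! ### The conjugation and the Hermitian dual -/

section Conjugation

variable {F G : Type*} [Field F] [AddCommGroup G]

/-- The conjugation `∑ u_g Y^g ↦ ∑ u_g ^ (p ^ ν) Y^(-g)` of the group algebra. -/
noncomputable def conj (F G : Type*) [Field F] [AddCommGroup G] (p ν : ℕ) [ExpChar F p] :
    F[G] →+* F[G] :=
  (AddMonoidAlgebra.mapDomainRingHom F (-AddMonoidHom.id G)).comp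
    (AddMonoidAlgebra.mapRingHom G (iterateFrobenius F p ν))

variable (p ν : ℕ) [ExpChar F p]

lemma conj_single (g : G) (a : F) :
    conj F G p ν (.single g a) = .single (-g) (a ^ p ^ ν) := by
  simp [conj, iterateFrobenius_def]

lemma coeff_conj (u : F[G]) (g : G) :
    (conj F G p ν u).coeff g = u.coeff (-g) ^ p ^ ν := by
  have h : (conj F G p ν u).coeff (-(-g)) = u.coeff (-g) ^ p ^ ν := by
    change (Finsupp.mapDomain _ _) _ = _
    erw [Finsupp.mapDomain_apply neg_injective]
    simp [iterateFrobenius_def]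
  simpa using h

lemma conj_conj [Finite F] (hF : Nat.card F = p ^ (2 * ν)) (u : F[G]) :
    conj F G p ν (conj F G p ν u) = u := by
  ext g
  have := Fintype.ofFinite F
  rw [coeff_conj, coeff_conj, neg_neg, ← pow_mul, ← pow_add, ← two_mul, ← hF,
    Nat.card_eq_fintype_card, FiniteField.pow_card]

lemma hermitianInner_eq_coeff [Fintype G] (u v : F[G]) :
    hermitianInner (p ^ ν) u v = (u * conj F G p ν v).coeff 0 := by
  rw [AddMonoidAlgebra.coeff_mul_apply_left, Finsupp.sum_fintype _ _ (by simp), hermitianInner]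
  simp [coeff_conj]

/-- An ideal is stable under translation by Y^(-g), so vanishing of the coefficient at 0 for every c
forces all coefficients to vanish. -/
lemma mem_hermitianDual_iff [Fintype G] (C : Ideal F[G]) (v : F[G]) :
    v ∈ hermitianDual (p ^ ν) C ↔ ∀ c ∈ C, c * conj F G p ν v = 0 := by
  refine ⟨fun h c hc ↦ ?_, fun h c hc ↦ ?_⟩
  · ext g
    have := h _ (C.mul_mem_left (.single (-g) 1) hc)
    rw [hermitianInner_eq_coeff, mul_assoc] at this
    simpa using this
  · rw [hermitianInner_eq_coeff, h c hc]
    simp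

end Conjugation

/-! ### Ideals generated by idempotents -/

/-- By induction I also meets the annihilator of each I^k trivially. The powers stabilize at an
idempotent ideal (e), and for x in I the element (1 - e)x lies in I and is killed by (e), so x = ex.
-/
lemma exists_idempotent_of_inf_annihilator {R : Type*} [CommRing R] [IsNoetherianRing R]
    [IsArtinianRing R] (I : Ideal R) (hI : ∀ x ∈ I, (∀ c ∈ I, c * x = 0) → x = 0) :
    ∃ e : R, IsIdempotentElem e ∧ I = Ideal.span {e} := by
  obtain ⟨m, hm⟩ := IsArtinian.monotone_stabilizes (R := R) (M := R)
    ⟨fun k ↦ OrderDual.toDual (I ^ k), fun a b h ↦ Ideal.pow_le_pow_right h⟩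
  replace hm : ∀ k, m ≤ k → I ^ m = I ^ k := hm
  have key : ∀ k, ∀ x ∈ I, (∀ c ∈ I ^ k, c * x = 0) → x = 0 := by
    intro k
    induction k with
    | zero => intro x _ h; simpa using h 1 (by simp)
    | succ k ih =>
      refine fun x hx h ↦ ih x hx fun c hc ↦ hI _ (I.mul_mem_left c hx) fun d hd ↦ ?_
      rw [← mul_assoc, mul_comm d c]
      exact h _ (by rw [pow_succ]; exact Ideal.mul_mem_mul hc hd)
  -- The exponent is m + 1 because a positive power is needed for e to lie in I.
  have hidem : IsIdempotentElem (I ^ (m + 1)) := by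
    rw [IsIdempotentElem, ← pow_add, ← hm (m + 1) (by omega), ← hm (m + 1 + (m + 1)) (by omega)]
  obtain ⟨e, he, hIe⟩ :=
    (Ideal.isIdempotentElem_iff_of_fg _ (IsNoetherian.noetherian _)).1 hidem
  have heI : e ∈ I := Ideal.pow_le_self (n := m + 1) (by omega)
    (hIe ▸ Ideal.mem_span_singleton_self e)
  refine ⟨e, he, le_antisymm (fun x hx ↦ ?_) ((Ideal.span_singleton_le_iff_mem _).2 heI)⟩
  have : (1 - e) * x = 0 := by
    refine key (m + 1) _ (I.mul_mem_left _ hx) fun c hc ↦ ?_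
    rw [hIe] at hc
    obtain ⟨d, rfl⟩ := Ideal.mem_span_singleton.1 hc
    linear_combination (-d * x) * he.eq
  exact Ideal.mem_span_singleton.2 ⟨x, by linear_combination this⟩

lemma idempotent_eq_of_span_eq {R : Type*} [CommRing R] {e f : R} (he : IsIdempotentElem e)
    (hf : IsIdempotentElem f) (h : Ideal.span {e} = Ideal.span {f}) : e = f := by
  obtain ⟨a, ha⟩ := Ideal.mem_span_singleton.1 (h ▸ Ideal.mem_span_singleton_self e)
  obtain ⟨b, hb⟩ := Ideal.mem_span_singleton.1 (h.symm ▸ Ideal.mem_span_singleton_self f)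
  have h1 : f * e = e := by rw [ha, ← mul_assoc, hf.eq]
  have h2 : e * f = f := by rw [hb, ← mul_assoc, he.eq]
  rw [← h1, mul_comm, h2]

/-! ### Complementary dual codes as fixed idempotents -/

section Count

variable {F G : Type*} [Field F] [Finite F] [AddCommGroup G] [Fintype G]
  (p ν : ℕ) [ExpChar F p]

instance finite_addMonoidAlgebra : Finite F[G] :=
  Finite.of_equiv (G → F) (Finsupp.equivFunOnFinite.symm.trans AddMonoidAlgebra.coeffEquiv.symm)

lemma isHermitianComplementaryDual_span (hF : Nat.card F = p ^ (2 * ν)) {e : F[G]}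
    (he : IsIdempotentElem e)
    (hc : conj F G p ν e = e) : IsHermitianComplementaryDual (p ^ ν) (Ideal.span {e}) := by
  refine Set.eq_singleton_iff_unique_mem.2 ⟨⟨zero_mem _, ?_⟩, ?_⟩
  · simp [mem_hermitianDual_iff]
  · rintro x ⟨hx, hx'⟩
    obtain ⟨d, rfl⟩ := Ideal.mem_span_singleton.1 hx
    have h := (mem_hermitianDual_iff p ν _ _).1 hx' e (Ideal.mem_span_singleton_self e)
    rw [map_mul, hc, ← mul_assoc, he.eq] at h
    have h' := congrArg (conj F G p ν) h
    rwa [map_mul, hc, conj_conj p ν hF, map_zero] at h'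

lemma exists_idempotent_of_isHermitianComplementaryDual (hF : Nat.card F = p ^ (2 * ν))
    {C : Ideal F[G]} (hC : IsHermitianComplementaryDual (p ^ ν) C) :
    ∃ e : F[G], (IsIdempotentElem e ∧ conj F G p ν e = e) ∧ C = Ideal.span {e} := by
  have hC0 : ∀ x ∈ C, (∀ c ∈ C, c * conj F G p ν x = 0) → x = 0 := fun x hx h ↦
    Set.mem_singleton_iff.1 (hC ▸ ⟨hx, (mem_hermitianDual_iff p ν C x).2 h⟩)
  -- If x is in the dual, then cx lies in C and in the dual, so it vanishes. Together with the
  -- involution this makes the annihilator of C stable under `conj`.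
  have h1 : ∀ x, (∀ c ∈ C, c * conj F G p ν x = 0) → ∀ c ∈ C, c * x = 0 := fun x h c hc ↦
    hC0 _ (C.mul_mem_right x hc) fun d hd ↦ by
      rw [map_mul, mul_left_comm, h d hd, mul_zero]
  have h2 : ∀ x, (∀ c ∈ C, c * x = 0) → ∀ c ∈ C, c * conj F G p ν x = 0 := fun x h ↦
    h1 _ (by simpa [conj_conj p ν hF] using h)
  obtain ⟨e, he, rfl⟩ := exists_idempotent_of_inf_annihilator C fun x hx h ↦ hC0 x hx (h2 x h)
  refine ⟨e, ⟨he, ?_⟩, rfl⟩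
  have hmem := Ideal.mem_span_singleton_self e
  -- Since 1 - e annihilates C, so does its conjugate. Hence e = e · `conj` e, and conjugating this
  -- identity gives `conj` e = e.
  have h3 : e * (1 - conj F G p ν e) = 0 := by
    have := h2 (1 - e) (fun c hc ↦ by
      obtain ⟨d, rfl⟩ := Ideal.mem_span_singleton.1 hc
      linear_combination (-d) * he.eq) e hmem
    simpa using this
  have h4 := congrArg (conj F G p ν) h3
  rw [map_mul, map_sub, map_one, conj_conj p ν hF, map_zero] at h4
  linear_combination h4 - h3

/-- Hermitian complementary dual codes correspond to idempotents fixed by the conjugation. -/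
lemma card_isHermitianComplementaryDual (hF : Nat.card F = p ^ (2 * ν)) :
    Nat.card {C : Ideal F[G] // IsHermitianComplementaryDual (p ^ ν) C} =
      Nat.card {e : F[G] // IsIdempotentElem e ∧ conj F G p ν e = e} := by
  symm
  refine Nat.card_eq_of_bijective
    (fun e ↦ ⟨Ideal.span {e.1}, isHermitianComplementaryDual_span p ν hF e.2.1 e.2.2⟩) ⟨?_, ?_⟩
  · intro e f h
    exact Subtype.ext (idempotent_eq_of_span_eq e.2.1 f.2.1 (congrArg Subtype.val h))
  · rintro ⟨C, hC⟩
    obtain ⟨e, he, rfl⟩ := exists_idempotent_of_isHermitianComplementaryDual p ν hF hC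
    exact ⟨⟨e, he⟩, rfl⟩

end Count

/-! ### Reduction from length n p^k to length n -/

section PrimePower

variable {F : Type*} [Field F] (p ν : ℕ) [ExpChar F p]

/-- Multiplication by `m` as an embedding of `ℤ/n` into `ℤ/nm`. -/
noncomputable def mulEmbedding (n m : ℕ) : ZMod n →+ ZMod (n * m) :=
  ZMod.lift n ⟨(AddMonoidHom.mulLeft (m : ZMod (n * m))).comp (Int.castAddHom _), by
    simp [mul_comm (m : ZMod (n * m)), ← Nat.cast_mul]⟩

lemma mulEmbedding_castHom (n m : ℕ) (g : ZMod (n * m)) :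
    mulEmbedding n m (ZMod.castHom (dvd_mul_right n m) (ZMod n) g) = m * g := by
  obtain ⟨a, rfl⟩ := ZMod.intCast_surjective g
  rw [map_intCast, mulEmbedding, ZMod.lift_coe]
  simp

lemma mulEmbedding_injective (n m : ℕ) [NeZero m] : Function.Injective (mulEmbedding n m) := by
  rw [injective_iff_map_eq_zero]
  intro x hx
  obtain ⟨a, rfl⟩ := ZMod.intCast_surjective x
  rw [mulEmbedding, ZMod.lift_coe] at hx
  have : ((m * a : ℤ) : ZMod (n * m)) = 0 := by simpa using hx
  rw [ZMod.intCast_zmod_eq_zero_iff_dvd, Nat.cast_mul, mul_comm] at this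
  exact (ZMod.intCast_zmod_eq_zero_iff_dvd _ _).2
    (Int.dvd_of_mul_dvd_mul_left (by exact_mod_cast NeZero.ne m) this)

lemma conj_mapDomainRingHom {G H : Type*} [AddCommGroup G] [AddCommGroup H] (φ : G →+ H)
    (u : F[G]) :
    conj F H p ν (AddMonoidAlgebra.mapDomainRingHom F φ u) =
      AddMonoidAlgebra.mapDomainRingHom F φ (conj F G p ν u) := by
  induction u using AddMonoidAlgebra.induction_linear with
  | zero => simp
  | add u v hu hv => rw [map_add, map_add, map_add, map_add, hu, hv]
  | single g a => simp [conj_single, AddMonoidAlgebra.mapDomain_single]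

/-- The p^k-th power map is additive and sends Y^g to Y^(p^k g), whose exponent depends only on g
modulo n. -/
lemma pow_mem_range_mapDomainRingHom (n k : ℕ) (u : F[ZMod (n * p ^ k)]) :
    u ^ p ^ k ∈ (AddMonoidAlgebra.mapDomainRingHom F (mulEmbedding n (p ^ k))).range := by
  have : ExpChar F[ZMod (n * p ^ k)] p :=
    expChar_of_injective_algebraMap (FaithfulSMul.algebraMap_injective F _) p
  induction u using AddMonoidAlgebra.induction_linear with
  | zero =>
    rw [zero_pow (pow_ne_zero k (expChar_pos F p).ne')]
    exact zero_mem _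
  | add u v hu hv =>
    rw [add_pow_expChar_pow]
    exact add_mem hu hv
  | single g a =>
    refine ⟨.single (ZMod.castHom (dvd_mul_right n (p ^ k)) (ZMod n) g) (a ^ p ^ k), ?_⟩
    rw [AddMonoidAlgebra.single_pow, AddMonoidAlgebra.mapDomainRingHom_apply,
      AddMonoidAlgebra.mapDomain_single, mulEmbedding_castHom, nsmul_eq_mul]

lemma card_fixed_idempotent_mul_pow (n k : ℕ) :
    Nat.card {e : F[ZMod (n * p ^ k)] // IsIdempotentElem e ∧ conj F _ p ν e = e} =
      Nat.card {e : F[ZMod n] // IsIdempotentElem e ∧ conj F _ p ν e = e} := by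
  have : NeZero (p ^ k) := ⟨pow_ne_zero k (expChar_pos F p).ne'⟩
  set Φ := AddMonoidAlgebra.mapDomainRingHom F (mulEmbedding n (p ^ k)) with hΦ
  have hinj : Function.Injective Φ :=
    AddMonoidAlgebra.mapDomain_injective (mulEmbedding_injective n (p ^ k))
  symm
  refine Nat.card_eq_of_bijective
    (fun e ↦ ⟨Φ e.1, e.2.1.map Φ, by rw [hΦ, conj_mapDomainRingHom, e.2.2]⟩) ⟨?_, ?_⟩
  · intro e f h
    exact Subtype.ext (hinj (congrArg Subtype.val h))
  · rintro ⟨e, he, hc⟩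
    obtain ⟨u, hu⟩ := pow_mem_range_mapDomainRingHom p n k e
    rw [he.pow_eq (NeZero.ne (p ^ k)), ← hΦ] at hu
    subst hu
    refine ⟨⟨u, hinj ?_, hinj ?_⟩, rfl⟩
    · rw [map_mul, he.eq]
    · rw [hΦ, ← conj_mapDomainRingHom, ← hΦ, hc]

end PrimePower

/-! ### Fourier transform on ℤ/n -/

section Transform

lemma mem_range_algebraMap_of_pow_card {F K : Type*} [Field F] [Finite F] [Field K] [Algebra F K]
    (x : K) (hx : x ^ Nat.card F = x) : ∃ a : F, algebraMap F K a = x := by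
  have := Fintype.ofFinite F
  rw [Nat.card_eq_fintype_card] at hx
  have hroots := FiniteField.roots_X_pow_card_sub_X F
  have hne := FiniteField.X_pow_card_sub_X_ne_zero F (Fintype.one_lt_card (α := F))
  have hs : (Polynomial.X ^ Fintype.card F - Polynomial.X : Polynomial F).Splits := by
    rw [Polynomial.splits_iff_card_roots, hroots,
      FiniteField.X_pow_card_sub_X_natDegree_eq F (Fintype.one_lt_card (α := F))]
    rfl
  exact hs.mem_range_of_isRoot hne (by simp [hx])

variable {F K : Type*} [Field F] [Field K] [Algebra F K] {n : ℕ} [NeZero n]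

/-- The Fourier coefficient at `j` of an element of `F[ℤ/n]`. -/
noncomputable def fourier (ψ : AddChar (ZMod n) K) (j : ZMod n) : F[ZMod n] →ₐ[F] K :=
  AddMonoidAlgebra.lift F K (ZMod n) (ψ.mulShift j).toMonoidHom

lemma fourier_apply (ψ : AddChar (ZMod n) K) (j : ZMod n) (u : F[ZMod n]) :
    fourier ψ j u = ∑ g, algebraMap F K (u.coeff g) * ψ (j * g) := by
  rw [fourier, AddMonoidAlgebra.lift_apply, Finsupp.sum_fintype _ _ (by simp)]
  exact Finset.sum_congr rfl fun g _ ↦ by rw [Algebra.smul_def]; rfl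

variable {ψ : AddChar (ZMod n) K}

lemma fourier_inversion (hψ : ψ.IsPrimitive) (f : ZMod n → K) (h : ZMod n) :
    ∑ j, (∑ g, f g * ψ (j * g)) * ψ (-(j * h)) = n * f h := by
  simp_rw [Finset.sum_mul]
  rw [Finset.sum_comm]
  have : ∀ g, ∑ j, f g * ψ (j * g) * ψ (-(j * h)) = if g = h then n * f h else 0 := by
    intro g
    have := AddChar.sum_mulShift (g - h) hψ
    simp_rw [mul_assoc, ← AddChar.map_add_eq_mul, ← sub_eq_add_neg, ← mul_sub,
      ← Finset.mul_sum, this, sub_eq_zero]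
    split_ifs with hg
    · rw [hg, ZMod.card, mul_comm]
    · simp
  simp [this]

lemma fourier_ext (hψ : ψ.IsPrimitive) (hn : (n : K) ≠ 0) {u v : F[ZMod n]} (h : ∀ j, fourier ψ j u = fourier ψ j v) :
    u = v := by
  ext g
  refine (algebraMap F K).injective (mul_left_cancel₀ hn ?_)
  rw [← fourier_inversion hψ (fun g ↦ algebraMap F K (u.coeff g)),
    ← fourier_inversion hψ (fun g ↦ algebraMap F K (v.coeff g))]
  simp_rw [← fourier_apply, h]

variable (p ν : ℕ) [ExpChar K p]

lemma fourier_conj [ExpChar F p] (j : ZMod n) (u : F[ZMod n]) :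
    fourier ψ (-(p ^ ν : ℕ) * j) (conj F _ p ν u) = fourier ψ j u ^ p ^ ν := by
  rw [fourier_apply, fourier_apply, sum_pow_char_pow, ← Equiv.sum_comp (Equiv.neg _)]
  refine Finset.sum_congr rfl fun g _ ↦ ?_
  rw [coeff_conj, mul_pow, map_pow, ← AddChar.map_nsmul_eq_pow]
  simp [mul_assoc]

/-- A function `f` on `ℤ/n` with `f (-q j) = f j ^ q` is the Fourier transform of an element of
`F[ℤ/n]`. -/
lemma exists_fourier_eq [Finite F] (hF : Nat.card F = p ^ (2 * ν))
    (hψ : ψ.IsPrimitive) (hn : (n : K) ≠ 0)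
    (hq : IsUnit (-(p ^ ν : ℕ) : ZMod n)) (f : ZMod n → K)
    (hf : ∀ j, f (-(p ^ ν : ℕ) * j) = f j ^ p ^ ν) :
    ∃ u : F[ZMod n], ∀ j, fourier ψ j u = f j := by
  obtain ⟨a, ha⟩ := hq
  have hQ : ∀ j, f ((a * a : (ZMod n)ˣ) * j) = f j ^ p ^ (2 * ν) := fun j ↦ by
    rw [Units.val_mul, mul_assoc, ha, hf, hf, ← pow_mul, ← pow_add, two_mul]
  -- The inverse transform takes values in K. They descend to F because reindexing by j ↦ q²j shows
  -- that they are fixed by the q²-power map.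
  have hw : ∀ g, ∃ b : F, algebraMap F K b = (n : K)⁻¹ * ∑ j, f j * ψ (g * -j) := fun g ↦ by
    apply mem_range_algebraMap_of_pow_card
    have hn' : (n : K) ^ p ^ (2 * ν) = n := by
      rw [← iterateFrobenius_def, map_natCast]
    rw [hF, mul_pow, inv_pow, hn', sum_pow_char_pow]
    congr 1
    rw [← Equiv.sum_comp (Units.mulLeft (a * a)) (fun j ↦ f j * ψ (g * -j))]
    refine Finset.sum_congr rfl fun j _ ↦ ?_
    rw [Units.mulLeft_apply, hQ, mul_pow, ← AddChar.map_nsmul_eq_pow]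
    congr 2
    rw [Units.val_mul, ha, nsmul_eq_mul, two_mul, pow_add]
    push_cast
    ring
  choose b hb using hw
  refine ⟨.ofCoeff (Finsupp.equivFunOnFinite.symm b), fun j ↦ ?_⟩
  rw [fourier_apply]
  have hinv := fourier_inversion hψ f j
  rw [← Equiv.sum_comp (Equiv.neg _)] at hinv
  refine mul_left_cancel₀ hn (Eq.trans ?_ hinv)
  rw [Finset.mul_sum]
  refine Finset.sum_congr rfl fun g _ ↦ ?_
  simp only [Finsupp.equivFunOnFinite_symm_apply_apply, hb, Equiv.neg_apply, neg_mul, neg_neg,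
    mul_neg]
  rw [mul_assoc, mul_inv_cancel_left₀ hn, mul_comm j g]

end Transform

/-- Idempotents of `F[ℤ/n]` fixed by the conjugation correspond to the subsets of `ℤ/n` that are
invariant under multiplication by `-q`. -/
lemma card_fixed_idempotent {F : Type*} [Field F] [Finite F] {n : ℕ} [NeZero n] (p ν : ℕ)
    [ExpChar F p] (hF : Nat.card F = p ^ (2 * ν)) (hn : (n : F) ≠ 0)
    (hq : IsUnit (-(p ^ ν : ℕ) : ZMod n)) :
    Nat.card {e : F[ZMod n] // IsIdempotentElem e ∧ conj F _ p ν e = e} =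
      Nat.card {S : Set (ZMod n) // ∀ j : ZMod n, -((p ^ ν : ℕ) : ZMod n) * j ∈ S ↔ j ∈ S} := by
  classical
  let K := AlgebraicClosure F
  have hnK : (n : K) ≠ 0 := by
    rw [← map_natCast (algebraMap F K)]
    exact (map_ne_zero _).2 hn
  have : NeZero (n : F) := ⟨hn⟩
  have : ExpChar K p := expChar_of_injective_algebraMap (algebraMap F K).injective p
  have h0 : (0 : K) ^ p ^ ν = 0 := zero_pow (pow_ne_zero _ (expChar_pos F p).ne')
  obtain ⟨ζ, hζ⟩ := HasEnoughRootsOfUnity.exists_primitiveRoot K n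
  set ψ : AddChar (ZMod n) K := AddChar.zmodChar n hζ.pow_eq_one
  have hψ : ψ.IsPrimitive := AddChar.zmodChar_primitive_of_primitive_root n hζ
  have h01 : ∀ e : F[ZMod n], IsIdempotentElem e → ∀ j, fourier ψ j e = 0 ∨ fourier ψ j e = 1 :=
    fun e he j ↦ IsIdempotentElem.iff_eq_zero_or_one.1 (he.map (fourier ψ j))
  -- The values 0 and 1 are fixed by the q-th power, so equivariance under -q becomes invariance.
  have hinv : ∀ e : F[ZMod n], IsIdempotentElem e → conj F _ p ν e = e →
      ∀ j, fourier ψ (-(p ^ ν : ℕ) * j) e = fourier ψ j e := fun e he hc j ↦ by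
    rw [← hc, fourier_conj, hc]
    rcases h01 e he j with h | h <;> simp [h, h0]
  refine Nat.card_eq_of_bijective (fun e ↦ ⟨{j | fourier ψ j e.1 = 1}, fun j ↦ by
    rw [Set.mem_ofPred_eq, hinv e.1 e.2.1 e.2.2, Set.mem_ofPred_eq]⟩) ⟨?_, ?_⟩
  · rintro ⟨e, he⟩ ⟨f, hf⟩ h
    refine Subtype.ext (fourier_ext hψ hnK fun j ↦ ?_)
    have hj : fourier ψ j e = 1 ↔ fourier ψ j f = 1 := Set.ext_iff.1 (congrArg Subtype.val h) j
    rcases h01 e he.1 j with h1 | h1 <;> rcases h01 f hf.1 j with h2 | h2 <;> simp_all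
  · rintro ⟨S, hS⟩
    obtain ⟨e, he⟩ := exists_fourier_eq p ν hF hψ hnK hq
      (fun j ↦ if j ∈ S then 1 else 0) (fun j ↦ by simp only [hS]; split_ifs <;> simp [h0])
    obtain ⟨a, ha⟩ := hq
    refine ⟨⟨e, fourier_ext hψ hnK fun j ↦ ?_, fourier_ext hψ hnK fun j ↦ ?_⟩, ?_⟩
    · rw [map_mul, he]
      simp
    · obtain ⟨i, rfl⟩ := (Units.mulLeft a).surjective j
      rw [Units.mulLeft_apply, ha, fourier_conj, he, he]
      simp only [hS]
      split_ifs <;> simp [h0]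
    · ext j
      simp [he]

/-! ### Invariant sets and orbit counting -/

section Orbits

-- Invariant sets are the preimages of arbitrary subsets of the orbit space.
open scoped Pointwise in
lemma card_invariant_sets {G α : Type*} [Group G] [MulAction G α] [Finite α] (a : G) :
    Nat.card {S : Set α // ∀ x, a • x ∈ S ↔ x ∈ S} =
      2 ^ Nat.card (MulAction.orbitRel.Quotient (Subgroup.zpowers a) α) := by
  classical
  have := Fintype.ofFinite (MulAction.orbitRel.Quotient (Subgroup.zpowers a) α)
  rw [Nat.card_eq_fintype_card (α := MulAction.orbitRel.Quotient _ _), ← Fintype.card_set,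
    ← Nat.card_eq_fintype_card]
  symm
  let π : α → MulAction.orbitRel.Quotient (Subgroup.zpowers a) α := Quotient.mk''
  refine Nat.card_eq_of_bijective (fun T ↦ ⟨π ⁻¹' T, fun x ↦ ?_⟩) ⟨?_, ?_⟩
  · have : π (a • x) = π x :=
      Quotient.sound' ⟨⟨a, Subgroup.mem_zpowers a⟩, rfl⟩
    rw [Set.mem_preimage, this, Set.mem_preimage]
  · intro S T h
    exact Set.preimage_injective.2 Quotient.mk''_surjective (congrArg Subtype.val h)
  · rintro ⟨S, hS⟩
    have hz : Subgroup.zpowers a ≤ MulAction.stabilizer G S :=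
      (Subgroup.zpowers_le).2 (MulAction.mem_stabilizer_set.2 hS)
    refine ⟨π '' S, Subtype.ext (Set.ext fun x ↦ ⟨?_, fun hx ↦ ⟨x, hx, rfl⟩⟩)⟩
    rintro ⟨y, hy, hxy⟩
    obtain ⟨⟨b, hb⟩, rfl⟩ := Quotient.exact' hxy
    exact (MulAction.mem_stabilizer_set.1 (hz hb) x).1 hy

/-- The minimal period of a point is the size of its orbit, so the reciprocals over one orbit add up
to 1. -/
lemma card_orbits_eq_sum_inv {G α : Type*} [Group G] [MulAction G α] [Fintype α] (a : G) :
    (Nat.card (MulAction.orbitRel.Quotient (Subgroup.zpowers a) α) : ℝ) =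
      ∑ x : α, (Function.minimalPeriod (a • · : α → α) x : ℝ)⁻¹ := by
  classical
  have := Fintype.ofFinite (MulAction.orbitRel.Quotient (Subgroup.zpowers a) α)
  let π : α → MulAction.orbitRel.Quotient (Subgroup.zpowers a) α := Quotient.mk''
  rw [← Finset.sum_fiberwise Finset.univ π, Nat.card_eq_fintype_card, ← Finset.card_univ,
    Finset.cast_card]
  refine Finset.sum_congr rfl fun ω _ ↦ ?_
  obtain ⟨x, rfl⟩ := Quotient.mk''_surjective ω
  have hper : ∀ y, (Function.minimalPeriod (a • · : α → α) y : ℝ) =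
      Nat.card (MulAction.orbit (Subgroup.zpowers a) y) := fun y ↦ by
    rw [Nat.card_congr (MulAction.orbitZPowersEquiv a y), Nat.card_zmod]
  have horb : ∀ y, π y = π x ↔ y ∈ MulAction.orbit (Subgroup.zpowers a) x := fun y ↦
    Quotient.eq''.trans MulAction.orbitRel_apply
  have hcard : (Finset.univ.filter fun y ↦ π y = π x).card =
      Nat.card (MulAction.orbit (Subgroup.zpowers a) x) := by
    rw [Nat.card_eq_card_toFinset]
    congr 1
    ext y
    simp [horb]
  have hpos : 0 < Nat.card (MulAction.orbit (Subgroup.zpowers a) x) :=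
    Nat.card_pos_iff.2 ⟨⟨x, MulAction.mem_orbit_self x⟩, inferInstance⟩
  rw [Finset.sum_congr rfl (g := fun _ ↦
    (Nat.card (MulAction.orbit (Subgroup.zpowers a) x) : ℝ)⁻¹), Finset.sum_const, hcard]
  · rw [nsmul_eq_mul, mul_inv_cancel₀ (by exact_mod_cast hpos.ne')]
  · intro y hy
    rw [hper, MulAction.orbit_eq_iff.2 ((horb y).1 (Finset.mem_filter.1 hy).2)]

/-- The point j is fixed by a^m exactly when its additive order divides b^m - 1. The integer lift b
lets one multiplier be reduced modulo every such order. -/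
lemma minimalPeriod_smul_zmod {n : ℕ} (a : (ZMod n)ˣ) (b : ℤ) (hab : (a : ZMod n) = b)
    (j : ZMod n) :
    Function.minimalPeriod (a • · : ZMod n → ZMod n) j =
      orderOf (b : ZMod (addOrderOf j)) := by
  refine Function.minimalPeriod_eq_minimalPeriod_iff.2 fun m ↦ ?_
  rw [isPeriodicPt_mul_iff_pow_eq_one, Function.IsPeriodicPt, Function.IsFixedPt, smul_iterate,
    show (a ^ m • · : ZMod n → ZMod n) j = a ^ m • j from rfl, Units.smul_def, Units.val_pow_eq_pow_val, hab, smul_eq_mul, ← sub_eq_zero,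
    ← sub_eq_zero (b := (1 : ZMod (addOrderOf j)))]
  have h := addOrderOf_dvd_iff_zsmul_eq_zero (x := j) (i := b ^ m - 1)
  rw [← ZMod.intCast_zmod_eq_zero_iff_dvd] at h
  push_cast at h
  rw [h, zsmul_eq_mul]
  push_cast
  rw [sub_mul, one_mul]

lemma card_orbits_zmod {n : ℕ} [NeZero n] (a : (ZMod n)ˣ) (b : ℤ) (hab : (a : ZMod n) = b) :
    (Nat.card (MulAction.orbitRel.Quotient (Subgroup.zpowers a) (ZMod n)) : ℝ) =
      ∑ d ∈ n.divisors, (Nat.totient d : ℝ) / orderOf (b : ZMod d) := by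
  classical
  rw [card_orbits_eq_sum_inv, ← Finset.sum_fiberwise_of_maps_to (t := n.divisors)
    (g := fun j ↦ addOrderOf j)]
  · refine Finset.sum_congr rfl fun d hd ↦ ?_
    rw [Finset.sum_congr rfl (g := fun _ ↦ (orderOf (b : ZMod d) : ℝ)⁻¹), Finset.sum_const,
      IsAddCyclic.card_addOrderOf_eq_totient (by simpa using Nat.dvd_of_mem_divisors hd),
      nsmul_eq_mul, div_eq_mul_inv]
    intro j hj
    obtain rfl := (Finset.mem_filter.1 hj).2
    rw [minimalPeriod_smul_zmod a b hab]
  · intro j _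
    exact Nat.mem_divisors.2 ⟨by simpa using addOrderOf_dvd_natCard j, NeZero.ne n⟩

end Orbits

/-! ### The order of -q modulo d -/

/-- Here (-q)^i = 1 with i odd, so -q has odd order and squaring preserves that order. -/
lemma orderOf_neg_of_lam_eq_one {d q : ℕ} (h : ∃ i : ℕ, Odd i ∧ d ∣ q ^ i + 1) :
    orderOf (-q : ZMod d) = orderOf ((q : ZMod d) ^ 2) := by
  obtain ⟨i, hi, hd⟩ := h
  have h1 : (-q : ZMod d) ^ i = 1 := by
    rw [hi.neg_pow, neg_eq_iff_add_eq_zero]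
    have := (ZMod.natCast_eq_zero_iff _ _).2 hd
    push_cast at this
    exact this
  have hodd : Odd (orderOf (-q : ZMod d)) := hi.of_dvd_nat (orderOf_dvd_of_pow_eq_one h1)
  rw [← neg_sq (q : ZMod d), Nat.Coprime.orderOf_pow]
  exact hodd.coprime_two_right

/-- An odd order i of -q would give d ∣ q^i + 1. The order is therefore even, and squaring halves
it. -/
lemma orderOf_neg_of_lam_eq_zero {d q : ℕ} (hq : q.Coprime d) (hd : d ≠ 0)
    (h : ¬ ∃ i : ℕ, Odd i ∧ d ∣ q ^ i + 1) :
    orderOf (-q : ZMod d) = 2 * orderOf ((q : ZMod d) ^ 2) := by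
  have : NeZero d := ⟨hd⟩
  have heven : 2 ∣ orderOf (-q : ZMod d) := by
    rw [← even_iff_two_dvd, ← Nat.not_odd_iff_even]
    refine fun ho ↦ h ⟨_, ho, (ZMod.natCast_eq_zero_iff _ _).1 ?_⟩
    have := pow_orderOf_eq_one (-q : ZMod d)
    rw [ho.neg_pow, neg_eq_iff_add_eq_zero] at this
    push_cast
    exact this
  have hpos : 0 < orderOf (-q : ZMod d) := by
    have hu : IsUnit (-q : ZMod d) := ((ZMod.isUnit_iff_coprime q d).2 hq).neg
    obtain ⟨u, hu⟩ := hu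
    rw [← hu, orderOf_units]
    exact orderOf_pos u
  rw [← neg_sq (q : ZMod d), orderOf_pow_of_dvd two_ne_zero heven]
  omega

lemma totient_div_orderOf_neg {d q : ℕ} (hq : q.Coprime d) (hd : d ≠ 0) :
    (Nat.totient d : ℝ) / orderOf (-q : ZMod d) =
      lam d q * ((Nat.totient d : ℝ) / ordMod d (q ^ 2)) +
        1 / 2 * ((1 - lam d q) * ((Nat.totient d : ℝ) / ordMod d (q ^ 2))) := by
  rw [ordMod, lam, Nat.cast_pow]
  split_ifs with h
  · rw [orderOf_neg_of_lam_eq_one h]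
    simp
  · rw [orderOf_neg_of_lam_eq_zero hq hd h]
    push_cast
    rw [mul_comm (2 : ℝ), ← div_div]
    ring

end CyclicLCD

theorem mainTheorem8 (p : ℕ) [Fact p.Prime] (ν : ℕ) (hν : 0 < ν) (n : ℕ) [NeZero n]
    (hpn : ¬ p ∣ n) (F : Type*) [Field F] (hF : Nat.card F = p ^ (2 * ν)) :
    (∀ k : ℕ, CyclicLCD.numHermitianLCDCyclic F (p ^ ν) (n * p ^ k) =
        CyclicLCD.numHermitianLCDCyclic F (p ^ ν) n) ∧
      (CyclicLCD.numHermitianLCDCyclic F (p ^ ν) n : ℝ) =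
        (2 : ℝ) ^
          ((∑ d ∈ n.divisors, (CyclicLCD.lam d (p ^ ν) : ℝ) *
              ((Nat.totient d : ℝ) / (CyclicLCD.ordMod d (p ^ (2 * ν)) : ℝ))) +
            (1 / 2 : ℝ) * ∑ d ∈ n.divisors, (1 - (CyclicLCD.lam d (p ^ ν) : ℝ)) *
              ((Nat.totient d : ℝ) / (CyclicLCD.ordMod d (p ^ (2 * ν)) : ℝ))) := by
  have hp : p.Prime := Fact.out
  have : Finite F := Nat.finite_of_card_ne_zero (hF ▸ pow_ne_zero _ hp.ne_zero)
  have : Fintype F := Fintype.ofFinite F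
  have hchar : CharP F p := charP_of_card_eq_prime_pow (f := 2 * ν)
    (by rw [← Nat.card_eq_fintype_card, hF])
  have hcop : ∀ d, d ∣ n → (p ^ ν).Coprime d := fun d hd ↦
    (((Nat.Prime.coprime_iff_not_dvd hp).2 hpn).coprime_dvd_right hd).pow_left ν
  have hq : IsUnit (-(p ^ ν : ℕ) : ZMod n) :=
    ((ZMod.isUnit_iff_coprime _ n).2 (hcop n dvd_rfl)).neg
  have hn : (n : F) ≠ 0 := fun h ↦ hpn ((CharP.cast_eq_zero_iff F p n).1 h)
  refine ⟨fun k ↦ ?_, ?_⟩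
  · simp only [CyclicLCD.numHermitianLCDCyclic]
    rw [CyclicLCD.card_isHermitianComplementaryDual p ν hF,
      CyclicLCD.card_isHermitianComplementaryDual p ν hF,
      CyclicLCD.card_fixed_idempotent_mul_pow p ν n k]
  · rw [CyclicLCD.numHermitianLCDCyclic, CyclicLCD.card_isHermitianComplementaryDual p ν hF,
      CyclicLCD.card_fixed_idempotent p ν hF hn hq]
    obtain ⟨a, ha⟩ := hq
    rw [← ha]
    have hcard := CyclicLCD.card_invariant_sets (α := ZMod n) a
    simp only [Units.smul_def, smul_eq_mul] at hcard
    rw [hcard, Nat.cast_pow, ← Real.rpow_natCast, Nat.cast_ofNat,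
      CyclicLCD.card_orbits_zmod a (-(p ^ ν : ℕ)) (by rw [ha]; push_cast; rfl), Finset.mul_sum,
      ← Finset.sum_add_distrib]
    congr 1
    refine Finset.sum_congr rfl fun d hd ↦ ?_
    have hdn := Nat.dvd_of_mem_divisors hd
    rw [mul_comm 2 ν, pow_mul,
      ← CyclicLCD.totient_div_orderOf_neg (hcop d hdn) (ne_zero_of_dvd_ne_zero (NeZero.ne n) hdn)]
    push_cast
    rfl
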